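/- Let $R$ be a profinite ring with unity, i.e. a (not necessarily commutative) compact, Hausdorff, totally disconnected topological ring with $1$. An étale space of (right, discrete) $R$-modules $(\mathcal A,p,X)$ consists of a topological space $\mathcal A$, a profinite space $X$, a local homeomorphism $p\colon\mathcal A\to X$, and a right $R$-module structure on each fibre $A_x=p^{-1}(x)$, such that the zero section $X\to\mathcal A$, $x\mapsto 0_x$, the fibrewise addition $\mathcal A\times_X\mathcal A\to\mathcal A$ and the action $\mathcal A\times R\to\mathcal A$ are continuous (each fibre is then a discrete $R$-module). A morphism $(\mathcal A,p,X)\to(\mathcal B,q,Y)$ is a pair $(\phi,f)$ of continuous maps $f\colon Y\to X$ and $\phi\colon\mathcal A\times_X Y\to\mathcal B$ such that, for each $y\in Y$, $\phi$ restricts to a morphism of $R$-modules $A_{f(y)}\times\{y\}\to B_y$. The composite of $(\phi,f)\colon(\mathcal A,p,X)\to(\mathcal B,q,Y)$ and $(\psi,g)\colon(\mathcal B,q,Y)\to(\mathcal C,r,Z)$ is given by $f\circ g$ and $(a,z)\mapsto\psi(\phi(a,g(z)),z)$. Call $(\mathcal A,p,X)$ finite if the set $\mathcal A$ is finite (then $X$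 is finite too). Then every étale space of $R$-modules is a direct limit of finite étale spaces of $R$-modules: for every étale space $\mathcal A$ of $R$-modules there are a nonempty directed partially ordered set $J$, a functor $j\mapsto\mathcal A_j$ from $J$ to the category of étale spaces of $R$-modules with every $\mathcal A_j$ finite, and morphisms $\mathcal A_j\to\mathcal A$ exhibiting $\mathcal A$ as the colimit of this diagram in the category of étale spaces of $R$-modules. -/

import Mathlib

open CategoryTheory

universe u v

/-- An étale space of right `R`-modules: a local homeomorphism `proj : total → base` onto a profinite
space, whose fibres are right `R`-modules (that is, `Rᵐᵒᵖ`-modules), such that the zero section, the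
addition `total ×_base total → total` and the action `total × R → total` are continuous. (The total
space is not assumed to be Hausdorff.) -/
structure EtaleModule (R : Type u) [Ring R] [TopologicalSpace R] where
  base : Profinite.{v}
  total : Type v
  [topology : TopologicalSpace total]
  proj : total → base
  isLocalHomeomorph_proj : IsLocalHomeomorph proj
  [addCommGroup : ∀ x : base, AddCommGroup {a : total // proj a = x}]
  [module : ∀ x : base, Module Rᵐᵒᵖ {a : total // proj a = x}]
  continuous_zero : Continuous fun x : base => ((0 : {a : total // proj a = x}) : total)
  continuous_add : Continuous fun z : {z : total × total // proj z.1 = proj z.2} =>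
    (((⟨z.1.1, rfl⟩ : {a : total // proj a = proj z.1.1}) + ⟨z.1.2, z.2.symm⟩ :
      {a : total // proj a = proj z.1.1}) : total)
  continuous_smul : Continuous fun z : total × R =>
    ((MulOpposite.op z.2 • (⟨z.1, rfl⟩ : {a : total // proj a = proj z.1}) :
      {a : total // proj a = proj z.1}) : total)

namespace EtaleModule

attribute [instance] EtaleModule.topology EtaleModule.addCommGroup EtaleModule.module

variable {R : Type u} [Ring R] [TopologicalSpace R]

/-- The fibre `A_x` of an étale space of modules, with the subspace topology. -/
abbrev Fibre (A : EtaleModule.{u, v} R) (x : A.base) : Type v := {a : A.total // A.proj a = x}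

/-- The fibres are automatically discrete. -/
theorem discreteTopology_fibre (A : EtaleModule.{u, v} R) (x : A.base) :
    DiscreteTopology (A.Fibre x) := by
  have h : IsLocalHomeomorphOn A.proj {a | A.proj a = x} := fun a _ => A.isLocalHomeomorph_proj a
  have : Subsingleton (A.proj '' {a | A.proj a = x}) := by
    refine ⟨?_⟩
    rintro ⟨_, a, ha, rfl⟩ ⟨_, b, hb, rfl⟩
    exact Subtype.ext (Eq.trans ha (Eq.symm hb))
  exact h.discreteTopology_of_image

/-- The fibres are automatically topological modules, hence discrete `R`-modules. -/
theorem continuousSMul_fibre (A : EtaleModule.{u, v} R) (x : A.base) :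
    ContinuousSMul Rᵐᵒᵖ (A.Fibre x) := by
  refine ⟨continuous_induced_rng.2 ?_⟩
  have h : Continuous fun z : Rᵐᵒᵖ × A.Fibre x => ((z.2 : A.total), z.1.unop) := by fun_prop
  refine (A.continuous_smul.comp h).congr ?_
  rintro ⟨r, a, rfl⟩
  rfl

/-- A morphism `(φ, f) : (A, p, X) → (B, q, Y)`: a continuous map `f : Y → X` together with a
continuous map `φ : A ×_X Y → B` which restricts to an `R`-linear map `A_{f(y)} → B_y` for every `y`.
The map `φ` is recorded through these restrictions, so that `φ (a, y) = fibreMap y a`. -/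
@[ext]
structure Hom (A B : EtaleModule.{u, v} R) where
  baseMap : C(B.base, A.base)
  fibreMap : ∀ y : B.base, A.Fibre (baseMap y) →ₗ[Rᵐᵒᵖ] B.Fibre y
  continuous_fibreMap : Continuous fun z : {z : A.total × B.base // A.proj z.1 = baseMap z.2} =>
    (fibreMap z.1.2 ⟨z.1.1, z.2⟩ : B.total)

/-- The identity morphism. -/
def Hom.id (A : EtaleModule.{u, v} R) : Hom A A where
  baseMap := ContinuousMap.id _
  fibreMap _ := LinearMap.id
  continuous_fibreMap := continuous_fst.comp continuous_subtype_val

/-- Composition of `(φ, f) : (A, p, X) → (B, q, Y)` and `(ψ, g) : (B, q, Y) → (C, r, Z)`: the map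
`f ∘ g : Z → X` together with `(a, z) ↦ ψ (φ (a, g z), z)`. -/
def Hom.comp {A B C : EtaleModule.{u, v} R} (φ : Hom A B) (ψ : Hom B C) : Hom A C where
  baseMap := φ.baseMap.comp ψ.baseMap
  fibreMap z := (ψ.fibreMap z).comp (φ.fibreMap (ψ.baseMap z))
  continuous_fibreMap := by
    have h1 : Continuous fun w : {w : A.total × C.base //
        A.proj w.1 = (φ.baseMap.comp ψ.baseMap) w.2} =>
        (φ.fibreMap (ψ.baseMap w.1.2) ⟨w.1.1, w.2⟩ : B.total) :=
      φ.continuous_fibreMap.comp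
        (Continuous.subtype_mk (f := fun w : {w : A.total × C.base //
          A.proj w.1 = (φ.baseMap.comp ψ.baseMap) w.2} => (w.1.1, ψ.baseMap w.1.2))
          (by fun_prop) fun w => w.2)
    exact ψ.continuous_fibreMap.comp
      (Continuous.subtype_mk (h1.prodMk (continuous_snd.comp continuous_subtype_val))
        fun w => (φ.fibreMap (ψ.baseMap w.1.2) ⟨w.1.1, w.2⟩).2)

/-- The category of étale spaces of right `R`-modules. -/
instance category : Category.{v} (EtaleModule.{u, v} R) where
  Hom := Hom
  id := Hom.id
  comp := Hom.comp

/-- An étale space of modules is finite if its total space is finite (the base, which embeds into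
the total space through the zero section, is then finite as well). -/
def IsFinite (A : EtaleModule.{u, v} R) : Prop := Finite A.total

end EtaleModule

/-! The space is rebuilt from its module of continuous global sections. Local sections over clopen
sets extend by zero, so a global section passes through every point (`exists_section_eq`). Two
sections agree on an open set; as the base and `R` are compact, the orbit map of a section is
locally constant on `R`, so each section generates a finite module (`finite_span_singleton`).

A stage is a discrete quotient `Q` of the base with a finite module `M` of sections; its fibre over
a class is `M` modulo the sections vanishing on that class. Stages grow by refining `Q` and
enlarging `M`, and map to `A` by evaluation.

Given compatible morphisms from the stages to `B`, the base maps assemble because the base is the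
limit of its discrete quotients, and each section gets a value at `y`. A section vanishing at the
image of `y` vanishes on a clopen neighbourhood, so its germ is already zero at some stage
(`sectionMap_eq_zero`); hence the values descend to the fibres of `A`. -/

namespace EtaleModule

variable {R : Type u} [Ring R] [TopologicalSpace R]

/-! ### Global sections and finiteness of cyclic modules -/

section Sections

variable {A : EtaleModule.{u, v} R}

theorem continuous_fibre_add {T : Type*} [TopologicalSpace T] {f : T → A.base}
    {s t : ∀ z, A.Fibre (f z)} (hs : Continuous fun z => (s z : A.total))
    (ht : Continuous fun z => (t z : A.total)) :
    Continuous fun z => ((s z + t z : A.Fibre (f z)) : A.total) := by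
  have h := A.continuous_add.comp (Continuous.subtype_mk (hs.prodMk ht)
    fun z => (s z).2.trans (t z).2.symm)
  refine h.congr fun z => ?_
  have key : ∀ (x : A.base) (a b : A.Fibre x) (hb : A.proj b.1 = A.proj a.1),
      (((⟨a.1, rfl⟩ : A.Fibre (A.proj a.1)) + ⟨b.1, hb⟩ : A.Fibre (A.proj a.1)) : A.total) =
        (a + b : A.Fibre x) := by
    rintro _ ⟨a, rfl⟩ b hb
    rfl
  exact key _ (s z) (t z) _

theorem continuous_fibre_smul {T : Type*} [TopologicalSpace T] {f : T → A.base}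
    {s : ∀ z, A.Fibre (f z)} {r : T → R} (hs : Continuous fun z => (s z : A.total))
    (hr : Continuous r) :
    Continuous fun z => ((MulOpposite.op (r z) • s z : A.Fibre (f z)) : A.total) := by
  refine (A.continuous_smul.comp (hs.prodMk hr)).congr fun z => ?_
  have key : ∀ (x : A.base) (a : A.Fibre x) (r : R),
      ((MulOpposite.op r • (⟨a.1, rfl⟩ : A.Fibre (A.proj a.1)) : A.Fibre (A.proj a.1)) : A.total) =
        (MulOpposite.op r • a : A.Fibre x) := by
    rintro _ ⟨a, rfl⟩ r
    rfl
  exact key _ (s z) (r z)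

/-- Two continuous families of points in the same fibres agree on an open set. -/
theorem isOpen_setOf_fibre_eq {T : Type*} [TopologicalSpace T] {f : T → A.base}
    {s t : ∀ z, A.Fibre (f z)} (hs : Continuous fun z => (s z : A.total))
    (ht : Continuous fun z => (t z : A.total)) : IsOpen {z | s z = t z} := by
  have h := A.isLocalHomeomorph_proj.isLocallyInjective.isOpen_eqLocus hs ht
    (funext fun z => (s z).2.trans (t z).2.symm)
  simpa only [Subtype.ext_iff] using h

variable (A)

/-- The submodule of continuous families in the product of the fibres. -/
def sectionSubmodule : Submodule Rᵐᵒᵖ (∀ x, A.Fibre x) where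
  carrier := {s | Continuous fun x => (s x : A.total)}
  zero_mem' := A.continuous_zero
  add_mem' hs ht := continuous_fibre_add hs ht
  smul_mem' r _ hs := continuous_fibre_smul (r := fun _ => r.unop) hs continuous_const

/-- The module of continuous global sections. -/
def Sections : Type v := A.sectionSubmodule

instance : AddCommGroup A.Sections := inferInstanceAs (AddCommGroup A.sectionSubmodule)

instance : Module Rᵐᵒᵖ A.Sections := inferInstanceAs (Module Rᵐᵒᵖ A.sectionSubmodule)

variable {A}

theorem continuous_section (s : A.Sections) : Continuous fun x => (s.1 x : A.total) := s.2

theorem isOpen_setOf_section_eq (s t : A.Sections) : IsOpen {x | s.1 x = t.1 x} :=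
  isOpen_setOf_fibre_eq (continuous_section s) (continuous_section t)

/-- A continuous section over a clopen set extends by zero to a global section. -/
theorem exists_section_extending {U : Set A.base} (hU : IsClopen U) (σ : A.base → A.total)
    (hσ : ContinuousOn σ U) (hσp : ∀ x ∈ U, A.proj (σ x) = x) :
    ∃ s : A.Sections, ∀ x ∈ U, (s.1 x : A.total) = σ x := by
  classical
  let s : ∀ x, A.Fibre x := fun x => if h : x ∈ U then ⟨σ x, hσp x h⟩ else 0
  have hs : ∀ x ∈ U, (s x : A.total) = σ x := fun x hx => by simp only [s, dif_pos hx]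
  have hs0 : ∀ x ∈ Uᶜ, s x = 0 := fun x hx => dif_neg hx
  refine ⟨⟨s, ?_⟩, hs⟩
  change Continuous fun x => (s x : A.total)
  rw [← continuousOn_univ, ← Set.union_compl_self U]
  refine ContinuousOn.union_of_isOpen (hσ.congr hs) ?_ hU.isOpen hU.compl.isOpen
  exact A.continuous_zero.continuousOn.congr fun x hx => by rw [hs0 x hx]

/-- Every point of the total space lies on a global section. -/
theorem exists_section_eq {x : A.base} (a : A.Fibre x) : ∃ s : A.Sections, s.1 x = a := by
  obtain ⟨a, rfl⟩ := a
  let e := A.isLocalHomeomorph_proj.localInverseAt a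
  obtain ⟨U, hU, hxU, hUe⟩ := compact_exists_isClopen_in_isOpen e.open_source
    (A.isLocalHomeomorph_proj.apply_self_mem_localInverseAt_source)
  obtain ⟨s, hs⟩ := exists_section_extending hU e (e.continuousOn.mono hUe)
    fun x hx => A.isLocalHomeomorph_proj.apply_localInverseAt_of_mem (hUe hx)
  refine ⟨s, Subtype.ext ?_⟩
  rw [hs _ hxU]
  exact A.isLocalHomeomorph_proj.localInverseAt_apply_self

/-- Evaluation of global sections at a point. -/
def evalSection (x : A.base) : A.Sections →ₗ[Rᵐᵒᵖ] A.Fibre x :=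
  (LinearMap.proj x).comp A.sectionSubmodule.subtype

theorem evalSection_surjective (x : A.base) : Function.Surjective (evalSection (A := A) x) :=
  exists_section_eq

/-- By compactness of the base, the multipliers taking one section to another one on a given
closed set form an open set. -/
theorem isOpen_setOf_smul_eqOn (s t : A.Sections) {C : Set A.base} (hC : IsClosed C) :
    IsOpen {r : R | ∀ x ∈ C, (MulOpposite.op r • s).1 x = t.1 x} := by
  have h : IsOpen {z : A.base × R | MulOpposite.op z.2 • s.1 z.1 = t.1 z.1} :=
    isOpen_setOf_fibre_eq (f := Prod.fst)
      (continuous_fibre_smul ((continuous_section s).comp continuous_fst) continuous_snd)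
      ((continuous_section t).comp continuous_fst)
  -- The excluded multipliers are the projection to `R` of a closed set of pairs, along the compact
  -- base.
  have h' := isClosedMap_snd_of_compactSpace _ (h.isClosed_compl.inter (hC.preimage continuous_fst))
  rw [← isClosed_compl_iff]
  convert h' using 1
  ext r
  simp only [Set.mem_compl_iff, Set.mem_ofPred_eq, Set.mem_image, Set.mem_inter_iff,
    Set.mem_preimage, Prod.exists, exists_eq_right, not_forall]
  exact ⟨fun ⟨x, hx, h⟩ => ⟨x, h, hx⟩, fun ⟨x, h, hx⟩ => ⟨x, hx, h⟩⟩

/-- A section generates a finite module, since the ring is compact. -/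
theorem finite_span_singleton [CompactSpace R] (s : A.Sections) :
    Finite (Submodule.span Rᵐᵒᵖ {s}) := by
  have hlc : IsLocallyConstant fun r : R => MulOpposite.op r • s := by
    rw [IsLocallyConstant.iff_eventually_eq]
    intro r₀
    have h := isOpen_setOf_smul_eqOn s (MulOpposite.op r₀ • s) isClosed_univ
    filter_upwards [h.mem_nhds (fun x _ => rfl)] with r hr
    exact Subtype.ext (funext fun x => hr x trivial)
  refine (hlc.range_finite.subset ?_ : (Submodule.span Rᵐᵒᵖ {s} : Set A.Sections).Finite)
  intro t ht
  obtain ⟨r, rfl⟩ := Submodule.mem_span_singleton.1 ht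
  exact ⟨r.unop, rfl⟩

end Sections

/-! ### Étale spaces over finite discrete bases -/

section OfFamily

variable (Q : Type v) [TopologicalSpace Q] [DiscreteTopology Q] [Finite Q]
  (N : Q → Type v) [∀ q, AddCommGroup (N q)] [∀ q, Module Rᵐᵒᵖ (N q)]

/-- The fibres of the projection from a sigma type. -/
def sigmaFibreEquiv {Q : Type v} (N : Q → Type v) (q : Q) : {a : Σ q, N q // a.1 = q} ≃ N q where
  toFun a := a.2 ▸ a.1.2
  invFun n := ⟨⟨q, n⟩, rfl⟩
  left_inv := by rintro ⟨⟨q, n⟩, rfl⟩; rfl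
  right_inv _ := rfl

/-- The étale space over a finite discrete space given by a family of modules on which the ring
acts with open stabilizers. -/
def ofFamily (hN : ∀ q (m n : N q), IsOpen {r : R | MulOpposite.op r • m = n}) :
    EtaleModule.{u, v} R :=
  letI : TopologicalSpace (Σ q, N q) := ⊥
  haveI : DiscreteTopology (Σ q, N q) := ⟨rfl⟩
  { base := Profinite.of Q
    total := Σ q, N q
    topology := ⊥
    proj := Sigma.fst
    isLocalHomeomorph_proj := by
      refine isLocalHomeomorph_iff_isOpenEmbedding_restrict.2 fun a =>
        ⟨{a}, (isOpen_discrete _).mem_nhds rfl, ?_⟩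
      exact .of_continuous_injective_isOpenMap continuous_of_discreteTopology
        (Function.injective_of_subsingleton _) fun _ _ => isOpen_discrete (α := Q) _
    addCommGroup := fun q => (sigmaFibreEquiv N q).addCommGroup
    module := fun q =>
      letI := (sigmaFibreEquiv N q).addCommGroup
      (sigmaFibreEquiv N q).module Rᵐᵒᵖ
    continuous_zero := continuous_of_discreteTopology (α := Q)
    continuous_add := continuous_of_discreteTopology
    continuous_smul := by
      -- With a discrete total space, only the preimages in `R` of points, for fixed `m`, matter:
      -- `hN` handles targets in the same fibre, and other targets have empty preimage.
      rw [continuous_prod_of_discrete_left]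
      rintro ⟨q, m⟩
      rw [continuous_discrete_rng]
      rintro ⟨q', n⟩
      by_cases h : q = q'
      · subst h
        convert hN q m n using 1
        ext r
        exact ⟨fun h => eq_of_heq (Sigma.mk.inj h).2, fun h => congrArg (Sigma.mk q) h⟩
      · convert isOpen_empty
        ext r
        exact ⟨fun h' => h (congrArg Sigma.fst h'), fun h' => h'.elim⟩ }

variable (hN : ∀ q (m n : N q), IsOpen {r : R | MulOpposite.op r • m = n})

variable {Q} in
/-- A point of the given finite space as a point of the base. -/
abbrev ofFamilyPoint (q : Q) : (ofFamily Q N hN).base := q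

/-- The fibres of `ofFamily Q N hN` are the members of the family. -/
def ofFamilyFibreEquiv (q : Q) :
    (ofFamily Q N hN).Fibre (ofFamilyPoint N hN q) ≃ₗ[Rᵐᵒᵖ] N q where
  __ := sigmaFibreEquiv N q
  map_add' _ _ := rfl
  map_smul' _ _ := rfl

end OfFamily

/-! ### The directed system of finite stages -/

section Stage

variable (A : EtaleModule.{u, v} R)

/-- The index set: a discrete quotient of the base and a finite module of global sections. -/
def StageIndex : Type v :=
  (DiscreteQuotient A.base)ᵒᵈ × {M : Submodule Rᵐᵒᵖ A.Sections // Finite M}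

instance : PartialOrder A.StageIndex :=
  inferInstanceAs
    (PartialOrder ((DiscreteQuotient A.base)ᵒᵈ × {M : Submodule Rᵐᵒᵖ A.Sections // Finite M}))

variable {A}

namespace StageIndex

/-- The finite quotient of the base belonging to an index. -/
abbrev quot (j : A.StageIndex) : DiscreteQuotient A.base := OrderDual.ofDual j.1

/-- The finite module of sections belonging to an index. -/
abbrev mod (j : A.StageIndex) : Submodule Rᵐᵒᵖ A.Sections := j.2.1

instance (j : A.StageIndex) : Finite j.mod := j.2.2

instance (j : A.StageIndex) : Finite (j.mod : Set A.Sections) := j.2.2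

/-- Finer discrete quotients are smaller, which is why the index carries the order dual. -/
theorem quot_le {i j : A.StageIndex} (h : i ≤ j) : j.quot ≤ i.quot := h.1

theorem mod_le {i j : A.StageIndex} (h : i ≤ j) : i.mod ≤ j.mod := h.2

instance : IsDirectedOrder A.StageIndex where
  directed i j := by
    have : Finite (i.mod ⊔ j.mod : Submodule Rᵐᵒᵖ A.Sections) := by
      refine (((Set.toFinite (i.mod : Set A.Sections)).add
        (Set.toFinite (j.mod : Set A.Sections))).subset ?_ :
          ((i.mod ⊔ j.mod : Submodule Rᵐᵒᵖ A.Sections) : Set A.Sections).Finite)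
      exact (Submodule.coe_sup _ _).le
    exact ⟨(i.1 ⊔ j.1, ⟨i.mod ⊔ j.mod, this⟩), ⟨le_sup_left, (le_sup_left : i.mod ≤ _)⟩,
      ⟨le_sup_right, (le_sup_right : j.mod ≤ _)⟩⟩

instance : Nonempty A.StageIndex :=
  ⟨(OrderDual.toDual ⊤, ⟨⊥, inferInstance⟩)⟩

/-- The sections in a finite module which vanish on a class of the finite quotient. -/
def vanishing (j : A.StageIndex) (q : j.quot) : Submodule Rᵐᵒᵖ j.mod where
  carrier := {s | ∀ x, j.quot.proj x = q → s.1.1 x = 0}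
  zero_mem' _ _ := rfl
  add_mem' {s t} hs ht x hx := by
    change s.1.1 x + t.1.1 x = 0
    rw [hs x hx, ht x hx, add_zero]
  smul_mem' r s hs x hx := by
    change r • s.1.1 x = 0
    rw [hs x hx, smul_zero]

/-- Classes in the quotient are equal exactly when their representatives agree on the preimage of
`q`, which is closed, so `isOpen_setOf_smul_eqOn` applies. -/
theorem isOpen_setOf_smul_eq (j : A.StageIndex) (q : j.quot) (m n : j.mod ⧸ j.vanishing q) :
    IsOpen {r : R | MulOpposite.op r • m = n} := by
  obtain ⟨s, rfl⟩ := Submodule.mkQ_surjective _ m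
  obtain ⟨t, rfl⟩ := Submodule.mkQ_surjective _ n
  convert isOpen_setOf_smul_eqOn s.1 t.1 (j.quot.isClosed_preimage {q}) using 1
  ext r
  simp only [Set.mem_ofPred_eq, ← map_smul]
  rw [← sub_eq_zero, ← map_sub, ← LinearMap.mem_ker, Submodule.ker_mkQ]
  exact forall₂_congr fun x _ => sub_eq_zero (a := (MulOpposite.op r • s.1).1 x) (b := t.1.1 x)

/-- The finite étale space over `j.quot` whose fibre at a class is the module of restrictions to
that class of the sections in `j.mod`. -/
def stage (j : A.StageIndex) : EtaleModule.{u, v} R :=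
  ofFamily j.quot (fun q => j.mod ⧸ j.vanishing q) j.isOpen_setOf_smul_eq

instance (j : A.StageIndex) : DiscreteTopology j.stage.total := ⟨rfl⟩

instance (j : A.StageIndex) : DiscreteTopology j.stage.base :=
  inferInstanceAs (DiscreteTopology j.quot)

theorem isFinite_stage (j : A.StageIndex) : j.stage.IsFinite := by
  have (q : j.quot) : Finite (j.mod ⧸ j.vanishing q) :=
    Finite.of_surjective _ (Submodule.mkQ_surjective _)
  exact inferInstanceAs (Finite (Σ q : j.quot, j.mod ⧸ j.vanishing q))

/-- The fibres of a finite stage. -/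
def fibreEquiv (j : A.StageIndex) (q : j.stage.base) :
    j.stage.Fibre q ≃ₗ[Rᵐᵒᵖ] j.mod ⧸ j.vanishing q :=
  ofFamilyFibreEquiv j.quot _ j.isOpen_setOf_smul_eq q

/-- The restriction of a section to a class. -/
def germ (j : A.StageIndex) (q : j.stage.base) : j.mod →ₗ[Rᵐᵒᵖ] j.stage.Fibre q :=
  (j.fibreEquiv q).symm.toLinearMap.comp (j.vanishing q).mkQ

theorem germ_surjective (j : A.StageIndex) (q : j.stage.base) : Function.Surjective (j.germ q) :=
  (j.fibreEquiv q).symm.surjective.comp (Submodule.mkQ_surjective _)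

theorem germ_eq_zero (j : A.StageIndex) (q : j.stage.base) {s : j.mod}
    (hs : ∀ x, j.quot.proj x = q → s.1.1 x = 0) : j.germ q s = 0 := by
  have h : (j.vanishing q).mkQ s = 0 := by
    rw [← LinearMap.mem_ker, Submodule.ker_mkQ]
    exact hs
  exact (congrArg (j.fibreEquiv q).symm h).trans (map_zero _)

/-- A morphism out of a finite stage, from compatible linear maps on sections. -/
def desc (j : A.StageIndex) {B : EtaleModule.{u, v} R} (f : C(B.base, j.stage.base))
    (ψ : ∀ y, j.mod →ₗ[Rᵐᵒᵖ] B.Fibre y)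
    (hψ : ∀ y (s : j.mod), (∀ x, j.quot.proj x = f y → s.1.1 x = 0) → ψ y s = 0)
    (hc : ∀ s, Continuous fun y => (ψ y s : B.total)) : j.stage ⟶ B where
  baseMap := f
  fibreMap y := ((j.vanishing (f y)).liftQ (ψ y) (hψ y)).comp
    (j.fibreEquiv (f y)).toLinearMap
  continuous_fibreMap := by
    refine continuous_iff_continuousAt.2 fun ⟨⟨a₀, y₀⟩, h₀⟩ => ?_
    -- The stage is discrete, so the first coordinate is locally constantly `a₀`, the germ of one
    -- section `s`; continuity reduces to `hc s`.
    obtain ⟨s, hs⟩ := j.germ_surjective _ ⟨a₀, rfl⟩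
    have hev : ∀ᶠ z : {z : j.stage.total × B.base // j.stage.proj z.1 = f z.2} in
        nhds ⟨⟨a₀, y₀⟩, h₀⟩, z.1.1 = a₀ :=
      ((continuous_fst.comp continuous_subtype_val).isOpen_preimage {a₀}
        (isOpen_discrete _)).mem_nhds rfl
    refine ContinuousAt.congr (f := fun z => (ψ z.1.2 s : B.total))
      ((hc s).comp (continuous_snd.comp continuous_subtype_val)).continuousAt ?_
    filter_upwards [hev]
    rintro ⟨⟨a, y⟩, h⟩ (rfl : a = a₀)
    have key : ∀ q (h : j.stage.proj a = q), (⟨a, h⟩ : j.stage.Fibre q) = j.germ q s := by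
      rintro _ rfl
      exact hs.symm
    change (ψ y s : B.total) = (((j.vanishing (f y)).liftQ (ψ y) (hψ y)).comp
      (j.fibreEquiv (f y)).toLinearMap (⟨a, h⟩ : j.stage.Fibre (f y)) : B.Fibre y)
    rw [key _ h]
    rfl

theorem hom_ext (j : A.StageIndex) {B : EtaleModule.{u, v} R} {φ φ' : j.stage ⟶ B}
    (hb : φ.baseMap = φ'.baseMap)
    (h : ∀ y s, φ.fibreMap y (j.germ _ s) = φ'.fibreMap y (j.germ _ s)) : φ = φ' := by
  obtain ⟨b, f, c⟩ := φ
  obtain ⟨b', f', c'⟩ := φ'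
  obtain rfl : b = b' := hb
  congr
  funext y
  refine LinearMap.ext fun a => ?_
  obtain ⟨s, rfl⟩ := j.germ_surjective _ a
  exact h y s

/-- The transition morphisms. -/
def transition {i j : A.StageIndex} (h : i ≤ j) : i.stage ⟶ j.stage :=
  i.desc (B := j.stage) ⟨DiscreteQuotient.ofLE (quot_le h), DiscreteQuotient.ofLE_continuous _⟩
    (fun q => (j.germ q).comp (Submodule.inclusion (mod_le h)))
    -- The class `q` lies inside its image class in the coarser quotient, so vanishing on the latter
    -- passes to `q`.
    (fun q s hs => germ_eq_zero j q fun x hx => hs x (by subst hx; rfl))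
    (fun _ => continuous_of_discreteTopology)

/-- The morphism from a finite stage to the étale space. -/
def toSpace (j : A.StageIndex) : j.stage ⟶ A :=
  j.desc ⟨j.quot.proj, j.quot.proj_continuous⟩
    (fun x => (evalSection x).comp j.mod.subtype)
    (fun x _ hs => hs x rfl) (fun s => continuous_section s.1)

end StageIndex

open StageIndex

variable (A)

/-- The directed system of finite stages. -/
def stageFunctor : A.StageIndex ⥤ EtaleModule.{u, v} R where
  obj j := j.stage
  map h := transition (leOfHom h)
  map_id j := hom_ext j (by ext ⟨x⟩; rfl) fun _ _ => rfl
  map_comp {i j k} f g := hom_ext i (by ext ⟨x⟩; rfl) fun _ _ => rfl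

/-- The cocone from the finite stages to the étale space. -/
def stageCocone : A.stageFunctor ⟶ (Functor.const A.StageIndex).obj A where
  app j := j.toSpace
  naturality i _ _ := hom_ext i rfl fun _ _ => rfl

end Stage

/-! ### The universal property -/

section Colimit

variable {A : EtaleModule.{u, v} R}

theorem Hom.ext_of_sections {B : EtaleModule.{u, v} R} {m m' : A ⟶ B}
    (hb : m.baseMap = m'.baseMap)
    (h : ∀ y (s : A.Sections), m.fibreMap y (s.1 _) = m'.fibreMap y (s.1 _)) : m = m' := by
  obtain ⟨b, f, c⟩ := m
  obtain ⟨b', f', c'⟩ := m'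
  obtain rfl : b = b' := hb
  congr
  funext y
  refine LinearMap.ext fun a => ?_
  obtain ⟨s, rfl⟩ := exists_section_eq a
  exact h y s

/-- Points of the base with the same image in all discrete quotients, taken at the given stages,
are equal. -/
theorem eq_of_forall_proj_eq {x x' : A.base}
    (h : ∀ j : A.StageIndex, j.quot.proj x = j.quot.proj x') : x = x' :=
  DiscreteQuotient.eq_of_forall_proj_eq fun Q => h (OrderDual.toDual Q, ⟨⊥, inferInstance⟩)

/-- The stage given by a discrete quotient and the module generated by one section. -/
def StageIndex.span [CompactSpace R] (Q : DiscreteQuotient A.base) (s : A.Sections) : A.StageIndex :=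
  (OrderDual.toDual Q, ⟨Submodule.span Rᵐᵒᵖ {s}, finite_span_singleton s⟩)

theorem StageIndex.mem_span [CompactSpace R] (Q : DiscreteQuotient A.base) (s : A.Sections) :
    s ∈ (StageIndex.span Q s).mod := Submodule.mem_span_singleton_self s

open StageIndex

/-- A compatible family of morphisms from the finite stages. -/
structure StageFamily (A B : EtaleModule.{u, v} R) where
  hom : ∀ j : A.StageIndex, j.stage ⟶ B
  transition_comp : ∀ {i j : A.StageIndex} (h : i ≤ j), transition h ≫ hom j = hom i

namespace StageFamily

variable {B : EtaleModule.{u, v} R} (φ : StageFamily A B)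

theorem baseMap_eq {i j : A.StageIndex} (h : i ≤ j) (y : B.base) :
    (φ.hom i).baseMap y = DiscreteQuotient.ofLE (quot_le h) ((φ.hom j).baseMap y) := by
  rw [← φ.transition_comp h]
  rfl

theorem exists_base (y : B.base) :
    ∃ x : A.base, ∀ j : A.StageIndex, j.quot.proj x = (φ.hom j).baseMap y := by
  -- The zero module suffices, since enlarging the module with `Q` fixed leaves the base map
  -- unchanged.
  let idx (Q : DiscreteQuotient A.base) : A.StageIndex :=
    (OrderDual.toDual Q, ⟨⊥, inferInstance⟩)
  obtain ⟨x, hx⟩ := DiscreteQuotient.exists_of_compat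
    (fun Q : DiscreteQuotient A.base => ((φ.hom (idx Q)).baseMap y : Q))
    fun P Q h => (φ.baseMap_eq (i := idx Q) (j := idx P) ⟨h, le_rfl⟩ y).symm
  refine ⟨x, fun j => (hx j.quot).trans ?_⟩
  have h : idx j.quot ≤ j := ⟨le_rfl, (bot_le : ⊥ ≤ j.mod)⟩
  refine (φ.baseMap_eq h y).trans ?_
  exact DiscreteQuotient.ofLE_refl_apply _

/-- The map on bases induced by a compatible family. -/
noncomputable def base (y : B.base) : A.base := (φ.exists_base y).choose

theorem proj_base (y : B.base) (j : A.StageIndex) : j.quot.proj (φ.base y) = (φ.hom j).baseMap y :=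
  (φ.exists_base y).choose_spec j

theorem continuous_base : Continuous φ.base := by
  refine isTopologicalBasis_isClopen.continuous_iff.2 fun C hC => ?_
  -- The quotient with classes `C` and its complement detects membership in `C` at a discrete stage.
  let j : A.StageIndex := (OrderDual.toDual (DiscreteQuotient.ofIsClopen hC), ⟨⊥, inferInstance⟩)
  convert (isOpen_discrete (j.quot.proj '' C : Set j.stage.base)).preimage (φ.hom j).baseMap.continuous using 1
  ext y
  change φ.base y ∈ C ↔ (φ.hom j).baseMap y ∈ (j.quot.proj '' C : Set j.stage.base)
  rw [← φ.proj_base y j]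
  refine ⟨fun h => ⟨_, h, rfl⟩, ?_⟩
  rintro ⟨x, hx, h⟩
  exact (Quotient.exact h).1 hx

/-- The value of a compatible family on a section of a finite stage. -/
def value (j : A.StageIndex) (y : B.base) : j.mod →ₗ[Rᵐᵒᵖ] B.Fibre y :=
  ((φ.hom j).fibreMap y).comp (j.germ _)

theorem value_inclusion {i j : A.StageIndex} (h : i ≤ j) (y : B.base) (s : i.mod) :
    φ.value j y (Submodule.inclusion (mod_le h) s) = φ.value i y s :=
  congrArg (fun ψ : i.stage ⟶ B => ψ.fibreMap y (i.germ _ s)) (φ.transition_comp h)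

/-- Both values agree with the one at a common upper bound, so the value depends only on the section
and not on the stage. -/
theorem value_eq (i j : A.StageIndex) (y : B.base) {s : A.Sections} (hi : s ∈ i.mod)
    (hj : s ∈ j.mod) : φ.value i y ⟨s, hi⟩ = φ.value j y ⟨s, hj⟩ := by
  obtain ⟨k, hik, hjk⟩ := exists_ge_ge i j
  rw [← φ.value_inclusion hik, ← φ.value_inclusion hjk]
  rfl

variable [CompactSpace R]

/-- The value of a compatible family on a global section. -/
def sectionMap (y : B.base) : A.Sections →ₗ[Rᵐᵒᵖ] B.Fibre y where
  -- The trivial quotient is an arbitrary choice, harmless by `value_eq`.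
  toFun s := φ.value (StageIndex.span ⊤ s) y ⟨s, mem_span ⊤ s⟩
  map_add' s t := by
    obtain ⟨k, hs, ht⟩ := exists_ge_ge (StageIndex.span ⊤ s) (StageIndex.span ⊤ t)
    have hs' : s ∈ k.mod := mod_le hs (mem_span ⊤ s)
    have ht' : t ∈ k.mod := mod_le ht (mem_span ⊤ t)
    rw [φ.value_eq _ k y _ hs', φ.value_eq _ k y _ ht', φ.value_eq _ k y _ (add_mem hs' ht'),
      ← map_add]
    rfl
  map_smul' r s := by
    rw [φ.value_eq _ (StageIndex.span ⊤ s) y _ (Submodule.smul_mem _ r (mem_span ⊤ s)),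
      RingHom.id_apply, ← map_smul]
    rfl

theorem value_eq_sectionMap (j : A.StageIndex) (y : B.base) (s : j.mod) :
    φ.value j y s = φ.sectionMap y s.1 := φ.value_eq _ _ y _ _

/-- Vanishing at a point spreads to a clopen neighbourhood `C`. In the stage whose quotient
separates `C` from its complement, the germ of `s` at the class `C` is zero. -/
theorem sectionMap_eq_zero (y : B.base) {s : A.Sections} (hs : s.1 (φ.base y) = 0) :
    φ.sectionMap y s = 0 := by
  obtain ⟨C, hC, hyC, hCs⟩ := compact_exists_isClopen_in_isOpen
    (isOpen_setOf_section_eq s 0) (x := φ.base y) hs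
  let j := StageIndex.span (DiscreteQuotient.ofIsClopen hC) s
  rw [← φ.value_eq_sectionMap j y ⟨s, mem_span _ s⟩]
  refine (congrArg ((φ.hom j).fibreMap y) (germ_eq_zero j _ fun x hx => ?_)).trans (map_zero _)
  rw [← φ.proj_base y j] at hx
  exact hCs ((Quotient.exact hx).2 hyC)

/-- The fibre is the module of global sections modulo those vanishing at the point, and `sectionMap`
kills the latter. -/
theorem exists_fibreMap (y : B.base) : ∃ l : A.Fibre (φ.base y) →ₗ[Rᵐᵒᵖ] B.Fibre y,
    ∀ s : A.Sections, l (s.1 _) = φ.sectionMap y s := by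
  let e := (evalSection (A := A) (φ.base y)).quotKerEquivOfSurjective (evalSection_surjective _)
  refine ⟨((LinearMap.ker (evalSection (φ.base y))).liftQ (φ.sectionMap y)
    fun s hs => φ.sectionMap_eq_zero y hs).comp e.symm.toLinearMap, fun s => ?_⟩
  have h : e.symm (s.1 _) = Submodule.Quotient.mk s := e.symm_apply_eq.2 rfl
  rw [LinearMap.comp_apply, LinearEquiv.coe_coe, h]
  rfl

/-- The maps on fibres induced by a compatible family. -/
noncomputable def fibreMap (y : B.base) : A.Fibre (φ.base y) →ₗ[Rᵐᵒᵖ] B.Fibre y :=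
  (φ.exists_fibreMap y).choose

theorem fibreMap_section (y : B.base) (s : A.Sections) :
    φ.fibreMap y (s.1 _) = φ.sectionMap y s := (φ.exists_fibreMap y).choose_spec s

/-- At a fixed stage the germ of `s` is a function on a discrete base, hence continuous. -/
theorem continuous_sectionMap (s : A.Sections) :
    Continuous fun y => (φ.sectionMap y s : B.total) := by
  let j := StageIndex.span ⊤ s
  let t : j.mod := ⟨s, mem_span ⊤ s⟩
  exact (φ.hom j).continuous_fibreMap.comp (Continuous.subtype_mk
    (f := fun y => (((j.germ ((φ.hom j).baseMap y) t : j.stage.total)), y))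
    (((continuous_of_discreteTopology (f := fun q => (j.germ q t : j.stage.total))).comp
      (φ.hom j).baseMap.continuous).prodMk continuous_id) fun y => (j.germ _ t).2)

/-- The morphism induced by a compatible family. -/
noncomputable def desc : A ⟶ B where
  baseMap := ⟨φ.base, φ.continuous_base⟩
  fibreMap := φ.fibreMap
  continuous_fibreMap := by
    refine continuous_iff_continuousAt.2 fun ⟨⟨a₀, y₀⟩, h₀⟩ => ?_
    obtain ⟨s, hs⟩ := exists_section_eq (⟨a₀, h₀⟩ : A.Fibre (φ.base y₀))
    -- Near the given point, the first coordinate stays on the section `s`, so continuity reduces to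
    -- `continuous_sectionMap`.
    have hev := (isOpen_setOf_fibre_eq
      (T := {z : A.total × B.base // A.proj z.1 = φ.base z.2}) (f := fun z => φ.base z.1.2)
      (s := fun z => ⟨z.1.1, z.2⟩) (t := fun z => s.1 _)
      (continuous_fst.comp continuous_subtype_val)
      ((continuous_section s).comp
        (φ.continuous_base.comp (continuous_snd.comp continuous_subtype_val)))).mem_nhds
      (x := ⟨⟨a₀, y₀⟩, h₀⟩) hs.symm
    refine ContinuousAt.congr (f := fun z => (φ.sectionMap z.1.2 s : B.total))
      ((φ.continuous_sectionMap s).comp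
        (continuous_snd.comp continuous_subtype_val)).continuousAt ?_
    filter_upwards [hev] with z hz
    have hz' : (⟨z.1.1, z.2⟩ : A.Fibre (φ.base z.1.2)) = s.1 _ := hz
    change _ = (φ.fibreMap z.1.2 ⟨z.1.1, z.2⟩ : B.total)
    rw [hz', fibreMap_section]

theorem toSpace_desc (j : A.StageIndex) : j.toSpace ≫ φ.desc = φ.hom j :=
  hom_ext j (ContinuousMap.ext fun y => φ.proj_base y j) fun y s =>
    (φ.fibreMap_section y s.1).trans (φ.value_eq_sectionMap j y s).symm

/-- Discrete quotients separate the points of the base, and every section belongs to the stage it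
generates. -/
theorem hom_ext_of_toSpace {m m' : A ⟶ B}
    (h : ∀ j : A.StageIndex, j.toSpace ≫ m = j.toSpace ≫ m') : m = m' := by
  refine Hom.ext_of_sections (ContinuousMap.ext fun y => eq_of_forall_proj_eq fun j => ?_)
    fun y s => ?_
  · exact congrArg (fun ψ : j.stage ⟶ B => ψ.baseMap y) (h j)
  · exact congrArg (fun ψ : (StageIndex.span ⊤ s).stage ⟶ B =>
      ψ.fibreMap y (germ _ _ ⟨s, mem_span ⊤ s⟩)) (h (StageIndex.span ⊤ s))

end StageFamily

variable (A) in
/-- An étale space is the colimit of its finite stages. -/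
noncomputable def isColimitStageCocone [CompactSpace R] :
    Limits.IsColimit (Limits.Cocone.mk A A.stageCocone) :=
  let fam (s : Limits.Cocone A.stageFunctor) : StageFamily A s.pt :=
    ⟨s.ι.app, fun h => s.w (homOfLE h)⟩
  { desc := fun s => (fam s).desc
    fac := fun s j => (fam s).toSpace_desc j
    uniq := fun s _ hm => StageFamily.hom_ext_of_toSpace fun j =>
      (hm j).trans ((fam s).toSpace_desc j).symm }

end Colimit

end EtaleModule

theorem mainTheorem8 {R : Type u} [Ring R] [TopologicalSpace R] [IsTopologicalRing R]
    [CompactSpace R] [T2Space R] [TotallyDisconnectedSpace R] (A : EtaleModule.{u, v} R) :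
    ∃ (J : Type v) (_ : PartialOrder J) (_ : Nonempty J) (_ : IsDirectedOrder J)
      (F : J ⥤ EtaleModule.{u, v} R) (ι : F ⟶ (Functor.const J).obj A),
      (∀ j : J, (F.obj j).IsFinite) ∧ Nonempty (Limits.IsColimit (Limits.Cocone.mk A ι)) :=
  ⟨A.StageIndex, inferInstance, inferInstance, inferInstance, A.stageFunctor, A.stageCocone,
    fun j => j.isFinite_stage, ⟨A.isColimitStageCocone⟩⟩
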